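/- Let $R$ be a commutative Noetherian ring and let $C$ be a semidualizing $R$-module, that is, a finitely generated $R$-module such that the homothety map $R\to\operatorname{Hom}_R(C,C)$ is an isomorphism and $\operatorname{Ext}^i_R(C,C)=0$ for all $i>0$. For a complex $X_\bullet=(\cdots\to X_{i+1}\to X_i\to X_{i-1}\to\cdots)$ of $R$-modules put $\inf X_\bullet=\inf\{i\in\mathbb Z\mid X_i\neq 0\}$ and $\operatorname{hinf}X_\bullet=\inf\{i\in\mathbb Z\mid H_i(X_\bullet)\neq 0\}$. A $C$-quasi-injective resolution of an $R$-module $N$ is a bounded complex $I_\bullet$ of injective $R$-modules such that $\operatorname{Hom}_R(C,I_\bullet)$ is not acyclic and, for every $i\in\mathbb Z$, $H_i(\operatorname{Hom}_R(C,I_\bullet))\cong N^{\oplus b_i}$ for some integer $b_i\ge 0$. The $C$-quasi-injective dimension of $N\neq 0$ is $$C\text{-}\operatorname{qid}_R N=\inf\{\operatorname{hinf}\operatorname{Hom}_R(C,I_\bullet)-\inf\operatorname{Hom}_R(C,I_\bullet)\mid I_\bullet\text{ is a } C\text{-quasi-injective resolution of }N\},$$ with $\inf\emptyset=\infty$, and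 $C\text{-}\operatorname{qid}_R N=-\infty$ if $N=0$. Let $M$ and $N$ be (not necessarily finitely generated) $R$-modules such that $C\text{-}\operatorname{qid}_R N<\infty$ and $\operatorname{Tor}^R_i(C,M)=0$ for all $i>0$. If $\operatorname{Ext}^i_R(M,N)=0$ for all sufficiently large $i$, then $\operatorname{Ext}^i_R(M,N)=0$ for all integers $i\ge 0$ with $i>C\text{-}\operatorname{qid}_R N$. -/

import Mathlib

universe u

open CategoryTheory

noncomputable section

namespace QuasiHom

variable {R : Type u} [CommRing R]

/-- A finitely generated module `C` is semidualizing if the homothety map `R → Hom_R(C, C)` is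
bijective and `Ext^i_R(C, C) = 0` for all `i > 0`. -/
structure IsSemidualizing (C : ModuleCat.{u} R) : Prop where
  finite : Module.Finite R C
  homothety_bijective : Function.Bijective (LinearMap.lsmul R C : R → (C →ₗ[R] C))
  ext_eq_zero : ∀ i : ℕ, 0 < i → Subsingleton (Abelian.Ext C C i)

/-- `inf X = inf {i | X_i ≠ 0}` for a complex `X` with differentials `X_i → X_{i-1}`;
it is `+∞` for the zero complex. -/
def cinf (X : ChainComplex (ModuleCat.{u} R) ℤ) : EReal :=
  sInf ((fun i : ℤ => ((i : ℝ) : EReal)) '' {i : ℤ | ¬ Limits.IsZero (X.X i)})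

/-- `hinf X = inf {i | H_i(X) ≠ 0}`; it is `+∞` for an acyclic complex. -/
def hinf (X : ChainComplex (ModuleCat.{u} R) ℤ) : EReal :=
  sInf ((fun i : ℤ => ((i : ℝ) : EReal)) '' {i : ℤ | ¬ Limits.IsZero (X.homology i)})

/-- A complex is bounded if its nonzero terms lie in a finite range of degrees. -/
def IsBounded (X : ChainComplex (ModuleCat.{u} R) ℤ) : Prop :=
  ∃ a b : ℤ, ∀ i : ℤ, i < a ∨ b < i → Limits.IsZero (X.X i)

/-- The complex `Hom_R(C, X)`, with `Hom_R(C, X_i)` in degree `i`. -/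
def homComplex (C : ModuleCat.{u} R) (X : ChainComplex (ModuleCat.{u} R) ℤ) :
    ChainComplex (ModuleCat.{u} R) ℤ :=
  (((linearCoyoneda R (ModuleCat.{u} R)).obj (Opposite.op C)).mapHomologicalComplex
    (ComplexShape.down ℤ)).obj X

/-- `I` is a `C`-quasi-injective resolution of `N`: a bounded complex of injective modules such
that `Hom_R(C, I)` is not acyclic and each of its homology modules is a direct sum of finitely
many (possibly zero) copies of `N`. -/
structure IsQuasiInjectiveResolution (C N : ModuleCat.{u} R)
    (I : ChainComplex (ModuleCat.{u} R) ℤ) : Prop where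
  bounded : IsBounded I
  injective : ∀ i : ℤ, Injective (I.X i)
  not_acyclic : ¬ (homComplex C I).Acyclic
  homology_iso : ∀ i : ℤ, ∃ b : ℕ,
    Nonempty ((homComplex C I).homology i ≅ ModuleCat.of R (Fin b → N))

open Classical in
/-- The `C`-quasi-injective dimension of `N`: it is `-∞` if `N = 0`, and otherwise the infimum of
`hinf Hom_R(C, I) - inf Hom_R(C, I)` over the `C`-quasi-injective resolutions `I` of `N`
(so `+∞` if there are none). -/
def cqid (C N : ModuleCat.{u} R) : EReal :=
  if Limits.IsZero N then ⊥
  else sInf {d : EReal | ∃ I : ChainComplex (ModuleCat.{u} R) ℤ,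
    IsQuasiInjectiveResolution C N I ∧ d = hinf (homComplex C I) - cinf (homComplex C I)}

end QuasiHom

end

namespace QuasiHom

open Limits Abelian

section Ext

variable {A : Type*} [Category* A] [Abelian A] [HasExt A] (M : A)

/-! Put `J = homComplex C I`, with lowest nonzero term in degree `s` and lowest nonzero homology in
degree `s + d`. By tensor-hom adjunction, Tor vanishing makes every term of `J` acyclic for `Ext(M,
-)` (`subsingleton_ext_ihom`). If `p > d` and `Ext^i(M, N) = 0` for all `i > p`, then in `0 → B → Z
→ H → 0` at degree `s + d`, exactness below gives `Ext^p(M, Z) = 0` and boundedness above gives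
`Ext^(p+1)(M, B) = 0`. Hence `Ext^p(M, H) = 0` (`subsingleton_ext_homology`), and `N` is a summand
of `H`. Descending induction on `p` concludes. -/

lemma subsingleton_ext_of_isZero {Y : A} (hY : IsZero Y) (n : ℕ) :
    Subsingleton (Ext M Y n) := by
  refine subsingleton_of_forall_eq 0 fun x => ?_
  rw [← Ext.comp_mk₀_id x, hY.eq_of_src (𝟙 Y) 0, Ext.mk₀_zero, Ext.comp_zero]

lemma subsingleton_ext_of_retract {Y Z : A} (r : Retract Y Z) {n : ℕ}
    (h : Subsingleton (Ext M Z n)) : Subsingleton (Ext M Y n) := by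
  refine subsingleton_of_forall_eq 0 fun x => ?_
  rw [← Ext.comp_mk₀_id x, ← r.retract, ← Ext.mk₀_comp_mk₀,
    ← Ext.comp_assoc_of_second_deg_zero, Subsingleton.elim (x.comp (Ext.mk₀ r.i) _) 0,
    Ext.zero_comp]

variable {S : ShortComplex A} (hS : S.ShortExact) {n : ℕ}
include hS

lemma subsingleton_ext_X₂ (h₁ : Subsingleton (Ext M S.X₁ n))
    (h₃ : Subsingleton (Ext M S.X₃ n)) : Subsingleton (Ext M S.X₂ n) := by
  refine subsingleton_of_forall_eq 0 fun x => ?_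
  obtain ⟨y, rfl⟩ := Ext.covariant_sequence_exact₂ M hS x (Subsingleton.elim _ _)
  rw [Subsingleton.elim y 0, Ext.zero_comp]

lemma subsingleton_ext_X₃ (h₂ : Subsingleton (Ext M S.X₂ n))
    (h₁ : Subsingleton (Ext M S.X₁ (n + 1))) : Subsingleton (Ext M S.X₃ n) := by
  refine subsingleton_of_forall_eq 0 fun x => ?_
  obtain ⟨y, rfl⟩ := Ext.covariant_sequence_exact₃ M hS x rfl (Subsingleton.elim _ _)
  rw [Subsingleton.elim y 0, Ext.zero_comp]

lemma subsingleton_ext_X₁ (h₃ : Subsingleton (Ext M S.X₃ n))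
    (h₂ : Subsingleton (Ext M S.X₂ (n + 1))) : Subsingleton (Ext M S.X₁ (n + 1)) := by
  refine subsingleton_of_forall_eq 0 fun x => ?_
  obtain ⟨y, rfl⟩ := Ext.covariant_sequence_exact₁ M hS x (Subsingleton.elim _ _) rfl
  rw [Subsingleton.elim y 0, Ext.zero_comp]

end Ext

section Complex

variable {A : Type*} [Category* A] [Abelian A] (X : ChainComplex A ℤ)

/-- The boundaries of a chain complex in degree `k`, as a subobject of the cycles. -/
noncomputable abbrev boundaries (k : ℤ) : A := kernel (X.homologyπ k)

/-- The short complex `B_k ⟶ Z_k ⟶ H_k`. -/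
noncomputable abbrev boundariesCycles (k : ℤ) : ShortComplex A :=
  ShortComplex.mk (kernel.ι (X.homologyπ k)) (X.homologyπ k) (kernel.condition _)

lemma boundariesCycles_shortExact (k : ℤ) : (boundariesCycles X k).ShortExact where
  exact := ShortComplex.exact_kernel _

/-- The short complex `Z_{k+1} ⟶ X_{k+1} ⟶ B_k`. -/
noncomputable abbrev cyclesBoundaries (k : ℤ) : ShortComplex A :=
  ShortComplex.mk (X.iCycles (k + 1))
    (kernel.lift (X.homologyπ k) (X.toCycles (k + 1) k) (by simp)) (by
      rw [← cancel_mono (kernel.ι _), ← cancel_mono (X.iCycles k)]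
      simp)

lemma cyclesBoundaries_shortExact (k : ℤ) : (cyclesBoundaries X k).ShortExact where
  exact := by
    have hk : (ComplexShape.down ℤ).next (k + 1) = k := by simp
    refine ShortComplex.exact_of_f_is_kernel _ (KernelFork.IsLimit.ofι' _ _ fun f hf => ?_)
    have hf' : f ≫ X.d (k + 1) k = 0 := by
      have := hf =≫ (kernel.ι (X.homologyπ k) ≫ X.iCycles k)
      simpa using this
    exact ⟨X.liftCycles f k hk hf', by simp⟩
  epi_g := by
    -- Surjectivity onto `B_k` is exactness of `X_{k+1} ⟶ Z_k ⟶ H_k`.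
    have hk : (ComplexShape.down ℤ).prev k = k + 1 := by simp
    have hex : (ShortComplex.mk (X.toCycles (k + 1) k) (X.homologyπ k) (by simp)).Exact :=
      ShortComplex.exact_of_g_is_cokernel _ (X.homologyIsCokernel (k + 1) k hk)
    exact (ShortComplex.exact_iff_epi_kernel_lift _).1 hex

variable [HasExt A] (M : A) {X}
  (hX : ∀ (k : ℤ) (i : ℕ), Subsingleton (Ext M (X.X k) (i + 1)))
include hX

/-- Dimension shifting along the exact sequence `0 → Z_{s+n} → X_{s+n} → ⋯ → X_s → 0`: each step up
costs one degree of Ext. -/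
lemma subsingleton_ext_cycles_of_exact_below {s : ℤ} (hs : ∀ k < s, IsZero (X.X k)) (n : ℕ)
    (hH : ∀ k < s + n, IsZero (X.homology k)) (i : ℕ) (hi : n < i) :
    Subsingleton (Ext M (X.cycles (s + n)) i) := by
  induction n generalizing i with
  | zero =>
    obtain ⟨i, rfl⟩ := Nat.exists_eq_add_of_lt hi
    have hZ : IsZero (X.cycles (s - 1)) :=
      IsZero.of_mono (X.iCycles (s - 1)) (hs _ (by lia))
    have hB : IsZero (boundaries X (s - 1)) := IsZero.of_mono (kernel.ι _) hZ
    have := subsingleton_ext_X₁ M (cyclesBoundaries_shortExact X (s - 1)) (n := 0 + i)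
      (subsingleton_ext_of_isZero M hB _) (hX _ _)
    have e : s - 1 + 1 = s + (0 : ℕ) := by lia
    rwa [← e]
  | succ n ih =>
    obtain ⟨i, rfl⟩ := Nat.exists_eq_add_of_lt hi
    have hB : Subsingleton (Ext M (boundaries X (s + n)) (n + i + 1)) :=
      subsingleton_ext_X₁ M (boundariesCycles_shortExact X (s + n))
        (subsingleton_ext_of_isZero M (hH _ (by lia)) _)
        (ih (fun k hk => hH k (by lia)) _ (by lia))
    have := subsingleton_ext_X₁ M (cyclesBoundaries_shortExact X (s + n)) hB (hX _ _)
    have e : s + n + 1 = s + (n + 1 : ℕ) := by lia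
    rw [← e]
    convert this using 2
    lia

lemma subsingleton_ext_boundaries {k : ℤ} {i : ℕ}
    (h : Subsingleton (Ext M (X.cycles (k + 1)) (i + 2))) :
    Subsingleton (Ext M (boundaries X k) (i + 1)) :=
  subsingleton_ext_X₃ M (cyclesBoundaries_shortExact X k) (hX _ _) h

/-- Descending induction on `k` from above `b`. Passing from `Z_{k+1}` to `B_k` lowers the Ext
degree, so the bound `p` does not depend on `k`. -/
lemma subsingleton_ext_cycles_of_homology {b : ℤ} (hb : ∀ k, b < k → IsZero (X.X k)) {p : ℕ}
    (hH : ∀ (k : ℤ) (i : ℕ), p < i → Subsingleton (Ext M (X.homology k) i))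
    (k : ℤ) (i : ℕ) (hi : p < i) : Subsingleton (Ext M (X.cycles k) i) := by
  obtain ⟨n, hn⟩ : ∃ n : ℕ, b < k + n := ⟨(b - k + 1).toNat, by lia⟩
  induction n generalizing k i with
  | zero =>
    exact subsingleton_ext_of_isZero M (IsZero.of_mono (X.iCycles k) (hb k (by lia))) _
  | succ n ih =>
    obtain ⟨i, rfl⟩ := Nat.exists_eq_add_of_lt hi
    exact subsingleton_ext_X₂ M (boundariesCycles_shortExact X k)
      (subsingleton_ext_boundaries M hX (ih (k + 1) _ (by lia) (by lia))) (hH _ _ (by lia))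

/-- If a bounded complex of `Ext(M, -)`-acyclic objects starts in degree `s` and is exact below
degree `s + d`, then vanishing of `Ext^i(M, H_k)` for all `i > p > d` and all `k` implies
vanishing of `Ext^p(M, H_{s + d})`. -/
lemma subsingleton_ext_homology {s b : ℤ} (hs : ∀ k < s, IsZero (X.X k))
    (hb : ∀ k, b < k → IsZero (X.X k)) {d p : ℕ} (hdp : d < p)
    (hd : ∀ k < s + d, IsZero (X.homology k))
    (hH : ∀ (k : ℤ) (i : ℕ), p < i → Subsingleton (Ext M (X.homology k) i)) :
    Subsingleton (Ext M (X.homology (s + d)) p) :=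
  subsingleton_ext_X₃ M (boundariesCycles_shortExact X (s + d))
    (subsingleton_ext_cycles_of_exact_below M hX hs d hd p hdp)
    (subsingleton_ext_boundaries M hX
      (subsingleton_ext_cycles_of_homology M hX hb hH _ _ (by lia)))

end Complex

section Module

variable {R : Type u} [CommRing R]

lemma subsingleton_ext_pi {M N : ModuleCat.{u} R} (b : ℕ) {i : ℕ}
    (h : Subsingleton (Ext M N i)) : Subsingleton (Ext M (ModuleCat.of R (Fin b → N)) i) := by
  refine subsingleton_of_forall_eq 0 fun x => ?_
  have key : 𝟙 (ModuleCat.of R (Fin b → N)) = ∑ j : Fin b,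
      (ModuleCat.ofHom (LinearMap.proj j) : ModuleCat.of R (Fin b → N) ⟶ N) ≫
        ModuleCat.ofHom (LinearMap.single R (fun _ : Fin b => (N : Type u)) j) := by
    refine ModuleCat.hom_ext (LinearMap.ext fun f => ?_)
    simpa [ModuleCat.hom_sum] using (LinearMap.sum_single_apply (fun _ => (N : Type u)) f).symm
  rw [← Ext.comp_mk₀_id x, key, Ext.mk₀_sum, Ext.comp_sum]
  refine Finset.sum_eq_zero fun j _ => ?_
  rw [← Ext.mk₀_comp_mk₀, ← Ext.comp_assoc_of_second_deg_zero,
    Subsingleton.elim (x.comp (Ext.mk₀ (ModuleCat.ofHom (LinearMap.proj j))) _) 0,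
    Ext.zero_comp]

lemma subsingleton_ext_of_pi {M N : ModuleCat.{u} R} {b : ℕ} (hb : 0 < b) {i : ℕ}
    (h : Subsingleton (Ext M (ModuleCat.of R (Fin b → N)) i)) : Subsingleton (Ext M N i) :=
  subsingleton_ext_of_retract M
    { i := ModuleCat.ofHom (LinearMap.single R (fun _ : Fin b => (N : Type u)) ⟨0, hb⟩)
      r := ModuleCat.ofHom (LinearMap.proj ⟨0, hb⟩)
      retract := by ext; simp } h

open MonoidalCategory in
/-- `Ext^i(M, Hom(C, E)) = 0` for `i > 0` if `E` is injective and `Tor_i(C, M) = 0` for `i > 0`. -/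
lemma subsingleton_ext_ihom (C M E : ModuleCat.{u} R) [Injective E]
    (hTor : ∀ i : ℕ, 0 < i → IsZero (((Tor (ModuleCat.{u} R) i).obj C).obj M)) (i : ℕ) :
    Subsingleton (Ext M ((ihom C).obj E) (i + 1)) := by
  refine subsingleton_of_forall_eq 0 fun x => ?_
  let P := projectiveResolution M
  obtain ⟨f, hf, rfl⟩ := P.extMk_surjective x (i + 2) rfl
  rw [P.extMk_eq_zero_iff f _ _ _ i rfl]
  -- The homology of `C ⊗ P` is Tor, so the transpose of the cocycle `f` factors through a boundary
  -- map by injectivity of `E`.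
  let K := (((tensoringLeft (ModuleCat.{u} R)).obj C).mapHomologicalComplex
    (ComplexShape.down ℕ)).obj P.complex
  have hK : K.ExactAt (i + 1) := by
    rw [K.exactAt_iff_isZero_homology]
    exact (hTor (i + 1) i.succ_pos).of_iso (P.isoLeftDerivedObj _ (i + 1)).symm
  rw [K.exactAt_iff' (i + 2) (i + 1) i (by simp) (by simp)] at hK
  have hf' : (K.sc' (i + 2) (i + 1) i).f ≫ MonoidalClosed.uncurry f = 0 := by
    change C ◁ P.complex.d (i + 2) (i + 1) ≫ MonoidalClosed.uncurry f = 0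
    rw [← MonoidalClosed.uncurry_natural_left, hf]
    simp [MonoidalClosed.uncurry_eq]
  obtain ⟨g, hg⟩ : ∃ g : C ⊗ P.complex.X i ⟶ E,
      C ◁ P.complex.d (i + 1) i ≫ g = MonoidalClosed.uncurry f :=
    ⟨_, hK.comp_descToInjective (MonoidalClosed.uncurry f) hf'⟩
  exact ⟨MonoidalClosed.curry g, by
    rw [← MonoidalClosed.curry_natural_left, hg, MonoidalClosed.curry_uncurry]⟩

lemma sInf_intCast_eq {P : ℤ → Prop} {a : ℤ} (ha : P a) (hle : ∀ k, P k → a ≤ k) :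
    sInf ((fun i : ℤ => ((i : ℝ) : EReal)) '' {i | P i}) = ((a : ℝ) : EReal) := by
  refine IsLeast.csInf_eq ⟨⟨a, ha, rfl⟩, ?_⟩
  rintro _ ⟨k, hk, rfl⟩
  exact EReal.coe_le_coe (Int.cast_le.2 (hle k hk))

lemma isZero_homComplex {C : ModuleCat.{u} R} {I : ChainComplex (ModuleCat.{u} R) ℤ} {k : ℤ}
    (h : IsZero (I.X k)) : IsZero ((homComplex C I).X k) :=
  Functor.map_isZero ((linearCoyoneda R (ModuleCat.{u} R)).obj (Opposite.op C)) h

/-- The invariants `hinf` and `cinf` of `Hom(C, I)` are attained, at degrees `s + d` and `s`. -/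
lemma IsQuasiInjectiveResolution.exists_degrees {C N : ModuleCat.{u} R}
    {I : ChainComplex (ModuleCat.{u} R) ℤ} (hI : IsQuasiInjectiveResolution C N I) :
    ∃ (s : ℤ) (d : ℕ), (∀ k < s, IsZero ((homComplex C I).X k)) ∧
      (∀ k < s + d, IsZero ((homComplex C I).homology k)) ∧
      ¬ IsZero ((homComplex C I).homology (s + d)) ∧
      hinf (homComplex C I) - cinf (homComplex C I) = ((d : ℝ) : EReal) := by
  obtain ⟨a, b, hab⟩ := hI.bounded
  set J := homComplex C I
  have hXH : ∀ k, IsZero (J.X k) → IsZero (J.homology k) := fun k hk =>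
    (HomologicalComplex.ExactAt.of_isZero hk).isZero_homology
  have ha : ∀ k, ¬ IsZero (J.X k) → a ≤ k := fun k hk => by
    by_contra! h
    exact hk (isZero_homComplex (hab k (Or.inl h)))
  obtain ⟨k, hk⟩ : ∃ k, ¬ IsZero (J.homology k) := by
    by_contra! h
    exact hI.not_acyclic fun k => (J.exactAt_iff_isZero_homology k).2 (h k)
  obtain ⟨h, hh, hhle⟩ := Int.exists_least_of_bdd (P := fun k => ¬ IsZero (J.homology k))
    ⟨a, fun k hk => ha k (mt (hXH k) hk)⟩ ⟨k, hk⟩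
  obtain ⟨s, hs, hsle⟩ := Int.exists_least_of_bdd (P := fun k => ¬ IsZero (J.X k))
    ⟨a, ha⟩ ⟨h, mt (hXH h) hh⟩
  obtain ⟨d, rfl⟩ := Int.le.dest (hsle h (mt (hXH h) hh))
  refine ⟨s, d, fun k hk => ?_, fun k hk => ?_, hh, ?_⟩
  · by_contra h
    exact absurd (hsle k h) (by lia)
  · by_contra h
    exact absurd (hhle k h) (by lia)
  · rw [hinf, cinf, sInf_intCast_eq hh hhle, sInf_intCast_eq hs hsle, ← EReal.coe_sub]
    simp

end Module

end QuasiHom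

open QuasiHom in
theorem mainTheorem12 {R : Type u} [CommRing R] [IsNoetherianRing R]
    (C M N : ModuleCat.{u} R) (hC : QuasiHom.IsSemidualizing C)
    (hN : QuasiHom.cqid C N < ⊤)
    (hTor : ∀ i : ℕ, 0 < i → Limits.IsZero (((Tor (ModuleCat.{u} R) i).obj C).obj M))
    (hExt : ∃ n : ℕ, ∀ i : ℕ, n < i → Subsingleton (Abelian.Ext M N i)) :
    ∀ i : ℕ, QuasiHom.cqid C N < ((i : ℝ) : EReal) → Subsingleton (Abelian.Ext M N i) := by
  intro i hi
  by_cases hN0 : Limits.IsZero N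
  · exact subsingleton_ext_of_isZero M hN0 i
  -- Strictness of `hi` yields a single resolution with `d < i`.
  rw [cqid, if_neg hN0, sInf_lt_iff] at hi
  obtain ⟨_, ⟨I, hI, rfl⟩, hlt⟩ := hi
  obtain ⟨s, d, hs, hd, hne, hdeg⟩ := hI.exists_degrees
  rw [hdeg] at hlt
  have hdi : d < i := by exact_mod_cast hlt
  obtain ⟨a, b, hab⟩ := hI.bounded
  obtain ⟨n, hn⟩ := hExt
  have hJ (k : ℤ) (i : ℕ) : Subsingleton (Abelian.Ext M ((homComplex C I).X k) (i + 1)) :=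
    haveI := hI.injective k
    subsingleton_ext_ihom C M (I.X k) hTor i
  have step (p : ℕ) (hp : d < p) (h : ∀ j, p < j → Subsingleton (Abelian.Ext M N j)) :
      Subsingleton (Abelian.Ext M N p) := by
    have hH := subsingleton_ext_homology M hJ hs
      (fun k hk => isZero_homComplex (hab k (Or.inr hk))) hp hd (fun k j hj => by
        obtain ⟨c, ⟨e⟩⟩ := hI.homology_iso k
        exact subsingleton_ext_of_retract M e.retract (subsingleton_ext_pi c (h j hj)))
    obtain ⟨c, ⟨e⟩⟩ := hI.homology_iso (s + d)
    refine subsingleton_ext_of_pi (Nat.pos_of_ne_zero ?_)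
      (subsingleton_ext_of_retract M e.symm.retract hH)
    rintro rfl
    exact hne ((ModuleCat.isZero_of_subsingleton _).of_iso e)
  -- Here `m` measures how far `j` may lie below the known vanishing range.
  have descent (m : ℕ) : ∀ j, d < j → n < j + m → Subsingleton (Abelian.Ext M N j) := by
    induction m with
    | zero => exact fun j _ hj => hn j hj
    | succ m ih => exact fun j hdj hj => step j hdj fun l hl => ih l (by lia) (by lia)
  exact descent (n + 1) i hdi (by lia)
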